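/- Let $\mathcal S=\mathcal S(\mathbb R)$ be the space of real-valued Schwartz functions and $\mathcal S'$ its topological dual (tempered distributions). Let $N+1=-\frac{d^2}{dx^2}+\frac{x^2}{4}+\frac12$ and, for $m\in\mathbb N_0$, $\|\varphi\|_m=\big(\int_{\mathbb R}|(N+1)^m\varphi(x)|^2\,dx\big)^{1/2}$. Let $\mathbf s'$ be the set of real sequences $(b_n)_{n\ge 0}$ with $|b_n|\le C(n+1)^k$ for some $C\in\mathbb R$, $k\in\mathbb N_0$ and all $n$, and $\mathbf s$ the set of real sequences $(a_n)_{n\ge0}$ with $\sum_{n\ge 0}(n+1)^{2k}|a_n|^2<\infty$ for all $k\in\mathbb N_0$. Put $$\mathcal H_{\mathbf s'}=\{(f_n)\in\mathcal S^{\mathbb N_0}: (\|f_n\|_m)_n\in\mathbf s'\ \text{for all } m\in\mathbb N_0\},\qquad \mathcal H_{\mathbf s}=\{(f_n)\in\mathcal S^{\mathbb N_0}: (\|f_n\|_m)_n\in\mathbf s\ \text{for all } m\in\mathbb N_0\},$$ and $\mathcal H=\mathcal H_{\mathbf s'}/\mathcal H_{\mathbf s}$, with $[f_n]$ denoting the class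 of $(f_n)$. On $\mathcal H$ let $D[f_n]=[f_n']$ and $l[f_n]=[l f_n]$ for $l\in\mathcal O_M$, where $\mathcal O_M$ is the ring of smooth functions $\mathbb R\to\mathbb R$ each of whose derivatives is bounded by a polynomial. Let $h_j(x)=(\sqrt{2\pi}\,j!)^{-1/2}e^{-x^2/4}H_j(x)$ with $H_j(x)=(-1)^je^{x^2/2}\frac{d^j}{dx^j}e^{-x^2/2}$ be the Hermite functions, and for $T\in\mathcal S'$ let $\iota(T)=[T_n]\in\mathcal H$, where $T_n=\sum_{j=0}^nT(h_j)h_j$. Two elements $[f_n],[g_n]\in\mathcal H$ are called associated, written $[f_n]\approx[g_n]$, if $\lim_{n\to\infty}\int_{\mathbb R}(f_n-g_n)\varphi\,dx=0$ for all $\varphi\in\mathcal S$. (All of these notions are well defined.) Then: (a) If $[f_n],[g_n]\in\mathcal H$ and $[f_n]\approx[g_n]$, then $D^\alpha[f_n]\approx D^\alpha[g_n]$ for every $\alpha\in\mathbb N_0$. (b) If $[f_n],[g_n]\in\mathcal H$, $[f_n]\approx[g_n]$ and $l\in\mathcal O_M$, then $l[f_n]\approx l[g_n]$. (c) If $T,S\in\mathcal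 S'$ and $\iota(T)\approx\iota(S)$, then $T=S$. -/

import Mathlib

open MeasureTheory Filter Topology
open scoped SchwartzMap

noncomputable section

namespace TemperedAlgebra

/-- The derivative `D : 𝓢 → 𝓢`. -/
def derivS : 𝓢(ℝ, ℝ) →L[ℝ] 𝓢(ℝ, ℝ) := SchwartzMap.derivCLM ℝ ℝ

/-- Multiplication by the coordinate, `f ↦ x f(x)`. -/
def mulX : 𝓢(ℝ, ℝ) →L[ℝ] 𝓢(ℝ, ℝ) := SchwartzMap.smulLeftCLM ℝ (fun x : ℝ => x)

/-- The operator `N + 1 = -d²/dx² + x²/4 + 1/2`. -/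
def numberSucc : 𝓢(ℝ, ℝ) →L[ℝ] 𝓢(ℝ, ℝ) :=
  -(derivS ∘L derivS) + (1 / 4 : ℝ) • (mulX ∘L mulX) +
    (1 / 2 : ℝ) • ContinuousLinearMap.id ℝ 𝓢(ℝ, ℝ)

/-- The norm `‖φ‖_m = (∫ |(N + 1)^m φ(x)|² dx)^(1/2)`. -/
def sNorm (m : ℕ) (φ : 𝓢(ℝ, ℝ)) : ℝ :=
  Real.sqrt (∫ x, |((numberSucc ^ m) φ) x| ^ 2)

/-! ### Pointwise formulas -/

theorem derivS_apply (f : 𝓢(ℝ, ℝ)) (x : ℝ) : derivS f x = deriv f x := rfl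

theorem mulX_apply (f : 𝓢(ℝ, ℝ)) (x : ℝ) : mulX f x = x * f x := by
  unfold mulX
  rw [SchwartzMap.smulLeftCLM_apply_apply Function.HasTemperateGrowth.id']
  rfl

theorem numberSucc_apply (f : 𝓢(ℝ, ℝ)) :
    numberSucc f = -derivS (derivS f) + (1 / 4 : ℝ) • mulX (mulX f) + (1 / 2 : ℝ) • f := rfl

theorem derivS_mulX (f : 𝓢(ℝ, ℝ)) : derivS (mulX f) = f + mulX (derivS f) := by
  ext x
  have h : HasDerivAt (fun y => y * f y) (1 * f x + x * deriv f x) x :=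
    (hasDerivAt_id x).mul (f.hasDerivAt x)
  have e : (mulX f : ℝ → ℝ) = fun y => y * f y := funext (mulX_apply f)
  rw [derivS_apply, e, h.deriv]
  simp [mulX_apply, derivS_apply]

theorem numberSucc_mulX (f : 𝓢(ℝ, ℝ)) :
    numberSucc (mulX f) = mulX (numberSucc f) - (2 : ℝ) • derivS f := by
  simp only [numberSucc_apply, derivS_mulX, map_add, map_neg, map_smul]
  module

theorem numberSucc_derivS (f : 𝓢(ℝ, ℝ)) :
    numberSucc (derivS f) = derivS (numberSucc f) - (1 / 2 : ℝ) • mulX f := by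
  simp only [numberSucc_apply, derivS_mulX, map_add, map_neg, map_smul]
  module

/-! ### The `L²` norm and inner product -/

/-- The embedding of `𝓢` into `L²`. -/
def toL2 : 𝓢(ℝ, ℝ) →L[ℝ] Lp ℝ 2 (volume : Measure ℝ) := SchwartzMap.toLpCLM ℝ ℝ 2 volume

theorem inner_toL2 (f g : 𝓢(ℝ, ℝ)) : inner ℝ (toL2 f) (toL2 g) = ∫ x, f x * g x := by
  apply integral_congr_ae
  filter_upwards [f.coeFn_toLp 2 volume, g.coeFn_toLp 2 volume] with x hf hg
  show inner ℝ ((f.toLp 2 volume : ℝ → ℝ) x) ((g.toLp 2 volume : ℝ → ℝ) x) = _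
  rw [hf, hg]
  simp [mul_comm]

theorem inner_derivS (f g : 𝓢(ℝ, ℝ)) :
    inner ℝ (toL2 (derivS f)) (toL2 g) = -inner ℝ (toL2 f) (toL2 (derivS g)) := by
  rw [inner_toL2, inner_toL2]
  have := SchwartzMap.integral_mul_deriv_eq_neg_deriv_mul f g
  simp only [derivS_apply]
  rw [this, neg_neg]

theorem inner_mulX (f g : 𝓢(ℝ, ℝ)) :
    inner ℝ (toL2 (mulX f)) (toL2 g) = inner ℝ (toL2 f) (toL2 (mulX g)) := by
  rw [inner_toL2, inner_toL2]
  congr 1; ext x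
  rw [mulX_apply, mulX_apply]; ring

theorem sNorm_eq (m : ℕ) (f : 𝓢(ℝ, ℝ)) : sNorm m f = ‖toL2 ((numberSucc ^ m) f)‖ := by
  rw [@norm_eq_sqrt_real_inner, inner_toL2]
  unfold sNorm
  congr 2; ext x
  rw [sq_abs, sq]

theorem sNorm_zero_eq (f : 𝓢(ℝ, ℝ)) : sNorm 0 f = ‖toL2 f‖ := by simp [sNorm_eq]

theorem sNorm_succ (m : ℕ) (f : 𝓢(ℝ, ℝ)) : sNorm (m + 1) f = sNorm m (numberSucc f) := by
  simp [sNorm_eq, pow_succ]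

theorem sNorm_nonneg (m : ℕ) (f : 𝓢(ℝ, ℝ)) : 0 ≤ sNorm m f := Real.sqrt_nonneg _

theorem sNorm_add (m : ℕ) (f g : 𝓢(ℝ, ℝ)) : sNorm m (f + g) ≤ sNorm m f + sNorm m g := by
  simp only [sNorm_eq, map_add]; exact norm_add_le _ _

theorem sNorm_smul (m : ℕ) (c : ℝ) (f : 𝓢(ℝ, ℝ)) : sNorm m (c • f) = |c| * sNorm m f := by
  simp only [sNorm_eq, map_smul, norm_smul, Real.norm_eq_abs]

theorem sNorm_sub (m : ℕ) (f g : 𝓢(ℝ, ℝ)) : sNorm m (f - g) ≤ sNorm m f + sNorm m g := by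
  simp only [sNorm_eq, map_sub]; exact norm_sub_le _ _

theorem sNorm_zero (m : ℕ) : sNorm m 0 = 0 := by simp [sNorm_eq]

theorem sNorm_sum (m : ℕ) {ι : Type*} (s : Finset ι) (f : ι → 𝓢(ℝ, ℝ)) :
    sNorm m (∑ i ∈ s, f i) ≤ ∑ i ∈ s, sNorm m (f i) := by
  simp only [sNorm_eq, map_sum]; exact norm_sum_le _ _

theorem inner_numberSucc (f : 𝓢(ℝ, ℝ)) :
    inner ℝ (toL2 (numberSucc f)) (toL2 f) =
      ‖toL2 (derivS f)‖ ^ 2 + 1 / 4 * ‖toL2 (mulX f)‖ ^ 2 + 1 / 2 * ‖toL2 f‖ ^ 2 := by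
  rw [numberSucc_apply]
  simp only [map_add, map_neg, map_smul, inner_add_left, inner_neg_left, inner_smul_left]
  rw [inner_derivS, inner_mulX]
  simp

/-! ### The family of norms controls the Schwartz seminorms -/

theorem norm_le_numberSucc (f : 𝓢(ℝ, ℝ)) : ‖toL2 f‖ ≤ 2 * ‖toL2 (numberSucc f)‖ := by
  have h := inner_numberSucc f
  have h2 := real_inner_le_norm (toL2 (numberSucc f)) (toL2 f)
  by_contra! hc
  nlinarith [sq_nonneg ‖toL2 (derivS f)‖, sq_nonneg ‖toL2 (mulX f)‖, norm_nonneg (toL2 f),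
    norm_nonneg (toL2 (numberSucc f))]

theorem norm_derivS_le (f : 𝓢(ℝ, ℝ)) : ‖toL2 (derivS f)‖ ≤ 3 * ‖toL2 (numberSucc f)‖ := by
  have h := inner_numberSucc f
  have h2 := real_inner_le_norm (toL2 (numberSucc f)) (toL2 f)
  have h3 := norm_le_numberSucc f
  have h4 := mul_le_mul_of_nonneg_left h3 (norm_nonneg (toL2 (numberSucc f)))
  apply le_of_sq_le_sq _ (by positivity)
  nlinarith [sq_nonneg ‖toL2 (mulX f)‖, sq_nonneg ‖toL2 f‖]

theorem norm_mulX_le (f : 𝓢(ℝ, ℝ)) : ‖toL2 (mulX f)‖ ≤ 3 * ‖toL2 (numberSucc f)‖ := by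
  have h := inner_numberSucc f
  have h2 := real_inner_le_norm (toL2 (numberSucc f)) (toL2 f)
  have h3 := norm_le_numberSucc f
  have h4 := mul_le_mul_of_nonneg_left h3 (norm_nonneg (toL2 (numberSucc f)))
  apply le_of_sq_le_sq _ (by positivity)
  nlinarith [sq_nonneg ‖toL2 (derivS f)‖, sq_nonneg ‖toL2 f‖]

theorem sNorm_le_succ (m : ℕ) (f : 𝓢(ℝ, ℝ)) : sNorm m f ≤ 2 * sNorm (m + 1) f := by
  rw [sNorm_eq, sNorm_eq, pow_succ']
  exact norm_le_numberSucc _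

theorem sNorm_mulX_derivS_le (m : ℕ) : ∃ C : ℝ, 0 ≤ C ∧ ∀ f : 𝓢(ℝ, ℝ),
    sNorm m (mulX f) ≤ C * sNorm (m + 1) f ∧ sNorm m (derivS f) ≤ C * sNorm (m + 1) f := by
  induction m with
  | zero =>
    refine ⟨3, by norm_num, fun f => ?_⟩
    rw [sNorm_succ]
    simp only [sNorm_zero_eq]
    exact ⟨norm_mulX_le f, norm_derivS_le f⟩
  | succ m ih =>
    obtain ⟨C, hC, h⟩ := ih
    refine ⟨5 * C, by positivity, fun f => ?_⟩
    have h1 := h (numberSucc f)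
    have h2 := h f
    simp only [← sNorm_succ] at h1
    have h3 : C * sNorm (m + 1) f ≤ C * (2 * sNorm (m + 1 + 1) f) :=
      mul_le_mul_of_nonneg_left (sNorm_le_succ _ _) hC
    have h4 := mul_nonneg hC (sNorm_nonneg (m + 1 + 1) f)
    rw [sNorm_succ m (mulX f), sNorm_succ m (derivS f), numberSucc_mulX, numberSucc_derivS]
    have h5 := sNorm_sub m (mulX (numberSucc f)) ((2 : ℝ) • derivS f)
    have h6 := sNorm_sub m (derivS (numberSucc f)) ((1 / 2 : ℝ) • mulX f)
    rw [sNorm_smul] at h5 h6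
    norm_num at h5 h6
    constructor <;> linarith [h1.1, h1.2, h2.1, h2.2]

theorem sNorm_le_add (m j : ℕ) (f : 𝓢(ℝ, ℝ)) : sNorm m f ≤ 2 ^ j * sNorm (m + j) f := by
  induction j with
  | zero => simp
  | succ j ih =>
    refine ih.trans ?_
    rw [pow_succ, mul_assoc]
    exact mul_le_mul_of_nonneg_left (sNorm_le_succ _ _) (by positivity)

theorem sNorm_mulX_iterate_le (k m : ℕ) : ∃ r : ℕ, ∃ C : ℝ, 0 ≤ C ∧ ∀ f : 𝓢(ℝ, ℝ),
    sNorm m (mulX^[k] f) ≤ C * sNorm r f := by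
  induction k generalizing m with
  | zero => exact ⟨m, 1, by norm_num, fun f => by simp⟩
  | succ k ih =>
    obtain ⟨r, C, hC, h⟩ := ih m
    obtain ⟨C', hC', h'⟩ := sNorm_mulX_derivS_le r
    refine ⟨r + 1, C * C', by positivity, fun f => ?_⟩
    rw [Function.iterate_succ_apply, mul_assoc]
    exact (h _).trans (mul_le_mul_of_nonneg_left (h' f).1 hC)

theorem sNorm_derivS_iterate_le (k m : ℕ) : ∃ r : ℕ, ∃ C : ℝ, 0 ≤ C ∧ ∀ f : 𝓢(ℝ, ℝ),
    sNorm m (derivS^[k] f) ≤ C * sNorm r f := by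
  induction k generalizing m with
  | zero => exact ⟨m, 1, by norm_num, fun f => by simp⟩
  | succ k ih =>
    obtain ⟨r, C, hC, h⟩ := ih m
    obtain ⟨C', hC', h'⟩ := sNorm_mulX_derivS_le r
    refine ⟨r + 1, C * C', by positivity, fun f => ?_⟩
    rw [Function.iterate_succ_apply, mul_assoc]
    exact (h _).trans (mul_le_mul_of_nonneg_left (h' f).2 hC)

theorem mulX_iterate_apply (k : ℕ) (f : 𝓢(ℝ, ℝ)) (x : ℝ) : (mulX^[k] f) x = x ^ k * f x := by
  induction k with
  | zero => simp
  | succ k ih => rw [Function.iterate_succ_apply', mulX_apply, ih, pow_succ']; ring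

theorem derivS_iterate_apply (k : ℕ) (f : 𝓢(ℝ, ℝ)) :
    (derivS^[k] f : ℝ → ℝ) = iteratedDeriv k f := by
  induction k with
  | zero => simp
  | succ k ih =>
    rw [Function.iterate_succ_apply', iteratedDeriv_succ, ← ih]
    rfl

theorem abs_apply_le (f : 𝓢(ℝ, ℝ)) (x : ℝ) : |f x| ≤ sNorm 0 f + sNorm 0 (derivS f) := by
  rw [sNorm_zero_eq, sNorm_zero_eq]
  have hint : ∀ g h : 𝓢(ℝ, ℝ), Integrable (fun y => g y * h y) := fun g h =>
    (SchwartzMap.pairing (ContinuousLinearMap.mul ℝ ℝ) g h).integrable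
  have hd : ∀ y ∈ Set.Iic x, HasDerivAt (fun y => f y * f y)
      (derivS f y * f y + f y * derivS f y) y := fun y _ => (f.hasDerivAt y).mul (f.hasDerivAt y)
  have hlim : Tendsto (fun y => f y * f y) atBot (𝓝 0) := by
    have := (f.tendsto_cocompact).mono_left (atBot_le_cocompact (α := ℝ))
    simpa using this.mul this
  have key := integral_Iic_of_hasDerivAt_of_tendsto' hd
    ((hint (derivS f) f).add (hint f (derivS f))).integrableOn hlim
  have hn : ∀ g : 𝓢(ℝ, ℝ), ‖toL2 g‖ ^ 2 = ∫ y, g y * g y := fun g => by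
    rw [← inner_toL2, real_inner_self_eq_norm_sq]
  have h1 : f x * f x ≤ ∫ y, (f y * f y + derivS f y * derivS f y) := by
    rw [sub_zero] at key
    rw [← key]
    refine (setIntegral_mono ((hint (derivS f) f).add (hint f (derivS f))).integrableOn
      ((hint f f).add (hint (derivS f) (derivS f))).integrableOn (fun y => ?_)).trans
      (setIntegral_le_integral ((hint f f).add (hint (derivS f) (derivS f)))
        (Filter.Eventually.of_forall fun y => ?_))
    · show derivS f y * f y + f y * derivS f y ≤ f y * f y + derivS f y * derivS f y
      nlinarith [sq_nonneg (f y - derivS f y)]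
    · show 0 ≤ f y * f y + derivS f y * derivS f y
      nlinarith [sq_nonneg (f y), sq_nonneg (derivS f y)]
  rw [integral_add (hint _ _) (hint _ _), ← hn, ← hn] at h1
  apply abs_le_of_sq_le_sq _ (by positivity)
  nlinarith [mul_nonneg (norm_nonneg (toL2 f)) (norm_nonneg (toL2 (derivS f)))]

theorem seminorm_le_sNorm (k n : ℕ) : ∃ r : ℕ, ∃ C : ℝ, 0 ≤ C ∧ ∀ f : 𝓢(ℝ, ℝ),
    SchwartzMap.seminorm ℝ k n f ≤ C * sNorm r f := by
  obtain ⟨r₁, C₁, hC₁, h₁⟩ := sNorm_mulX_iterate_le k 1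
  obtain ⟨C₂, hC₂, h₂⟩ := sNorm_mulX_derivS_le 0
  obtain ⟨r₃, C₃, hC₃, h₃⟩ := sNorm_derivS_iterate_le n r₁
  refine ⟨r₃, (2 + C₂) * (C₁ * C₃), by positivity, fun f => ?_⟩
  refine SchwartzMap.seminorm_le_bound' ℝ k n f
    (mul_nonneg (by positivity) (sNorm_nonneg _ _)) fun x => ?_
  set g := mulX^[k] (derivS^[n] f) with hg
  have e : |x| ^ k * ‖iteratedDeriv n f x‖ = |g x| := by
    rw [hg, mulX_iterate_apply, derivS_iterate_apply, abs_mul, abs_pow, Real.norm_eq_abs]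
  rw [e]
  have a1 := abs_apply_le g x
  have a2 := sNorm_le_succ 0 g
  have a3 := (h₂ g).2
  have a4 := (h₁ (derivS^[n] f)).trans (mul_le_mul_of_nonneg_left (h₃ f) hC₁)
  have a5 : (2 + C₂) * sNorm 1 g ≤ (2 + C₂) * (C₁ * (C₃ * sNorm r₃ f)) :=
    mul_le_mul_of_nonneg_left a4 (by positivity)
  norm_num at a2 a3
  nlinarith

theorem exists_bound_of_continuous (q : Seminorm ℝ 𝓢(ℝ, ℝ)) (hq : Continuous q) :
    ∃ r : ℕ, ∃ C : ℝ, 0 ≤ C ∧ ∀ f, q f ≤ C * sNorm r f := by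
  obtain ⟨s, C, -, h⟩ := Seminorm.bound_of_continuous (schwartz_withSeminorms ℝ ℝ ℝ) q hq
  have hs : ∃ r : ℕ, ∃ C : ℝ, 0 ≤ C ∧ ∀ f,
      (s.sup (schwartzSeminormFamily ℝ ℝ ℝ)) f ≤ C * sNorm r f := by
    clear h
    induction s using Finset.induction_on with
    | empty => exact ⟨0, 0, le_rfl, fun f => by simp⟩
    | insert a s _ ih =>
      obtain ⟨r₁, C₁, hC₁, h₁⟩ := ih
      obtain ⟨r₂, C₂, hC₂, h₂⟩ := seminorm_le_sNorm a.1 a.2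
      refine ⟨r₁ + r₂, C₁ * 2 ^ r₂ + C₂ * 2 ^ r₁, by positivity, fun f => ?_⟩
      have b1 := mul_le_mul_of_nonneg_left (sNorm_le_add r₁ r₂ f) hC₁
      have b2 := mul_le_mul_of_nonneg_left (sNorm_le_add r₂ r₁ f) hC₂
      rw [add_comm r₂ r₁] at b2
      have n1 := mul_nonneg (mul_nonneg hC₁ (pow_nonneg zero_le_two r₂))
        (sNorm_nonneg (r₁ + r₂) f)
      have n2 := mul_nonneg (mul_nonneg hC₂ (pow_nonneg zero_le_two r₁))
        (sNorm_nonneg (r₁ + r₂) f)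
      rw [Finset.sup_insert, Seminorm.sup_apply]
      apply max_le
      · have := h₂ f
        change SchwartzMap.seminorm ℝ a.1 a.2 f ≤ _
        linarith
      · have := h₁ f
        linarith
  obtain ⟨r, C', hC', h'⟩ := hs
  refine ⟨r, C * C', by positivity, fun f => (h f).trans ?_⟩
  rw [mul_assoc]
  exact mul_le_mul_of_nonneg_left (h' f) C.2

theorem exists_sNorm_map_le (A : 𝓢(ℝ, ℝ) →L[ℝ] 𝓢(ℝ, ℝ)) (m : ℕ) :
    ∃ r : ℕ, ∃ C : ℝ, 0 ≤ C ∧ ∀ f, sNorm m (A f) ≤ C * sNorm r f := by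
  obtain ⟨r, C, hC, h⟩ := exists_bound_of_continuous
    ((normSeminorm ℝ (Lp ℝ 2 (volume : Measure ℝ))).comp
      (toL2 ∘L (numberSucc ^ m) ∘L A).toLinearMap)
    (continuous_norm.comp (toL2 ∘L (numberSucc ^ m) ∘L A).continuous)
  refine ⟨r, C, hC, fun f => ?_⟩
  rw [sNorm_eq]
  exact h f

theorem exists_abs_apply_le (T : 𝓢(ℝ, ℝ) →L[ℝ] ℝ) :
    ∃ r : ℕ, ∃ C : ℝ, 0 ≤ C ∧ ∀ f, |T f| ≤ C * sNorm r f :=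
  exists_bound_of_continuous ((normSeminorm ℝ ℝ).comp T.toLinearMap)
    (continuous_norm.comp T.continuous)

/-! ### Hermite functions -/

theorem exists_poly_mul_gaussian_le (p : Polynomial ℝ) :
    ∃ C : ℝ, ∀ x : ℝ, |p.eval x * Real.exp (-x ^ 2 / 4)| ≤ C := by
  induction p using Polynomial.induction_on' with
  | add p q hp hq =>
    obtain ⟨C, hC⟩ := hp
    obtain ⟨C', hC'⟩ := hq
    refine ⟨C + C', fun x => ?_⟩
    rw [Polynomial.eval_add, add_mul]
    exact (abs_add_le _ _).trans (add_le_add (hC x) (hC' x))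
  | monomial k a =>
    refine ⟨|a| * (k.factorial * Real.exp 1), fun x => ?_⟩
    rw [Polynomial.eval_monomial, abs_mul, abs_mul, abs_pow, abs_of_pos (Real.exp_pos _), mul_assoc]
    refine mul_le_mul_of_nonneg_left ?_ (abs_nonneg a)
    have h1 : |x| ^ k ≤ k.factorial * Real.exp |x| := by
      have := Real.pow_div_factorial_le_exp |x| (abs_nonneg x) k
      rw [div_le_iff₀ (by positivity)] at this
      linarith
    calc |x| ^ k * Real.exp (-x ^ 2 / 4)
        ≤ (k.factorial * Real.exp |x|) * Real.exp (-x ^ 2 / 4) :=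
          mul_le_mul_of_nonneg_right h1 (Real.exp_pos _).le
      _ = k.factorial * Real.exp (|x| + -x ^ 2 / 4) := by rw [Real.exp_add]; ring
      _ ≤ k.factorial * Real.exp 1 := by
          gcongr
          rw [← sq_abs]
          nlinarith [sq_nonneg (|x| - 2)]

theorem hasDerivAt_poly_mul_gaussian (p : Polynomial ℝ) (x : ℝ) :
    HasDerivAt (fun x : ℝ => p.eval x * Real.exp (-x ^ 2 / 4))
      ((p.derivative - Polynomial.C (1 / 2) * Polynomial.X * p).eval x *
        Real.exp (-x ^ 2 / 4)) x := by
  have h1 : HasDerivAt (fun x : ℝ => -x ^ 2 / 4) (-x / 2) x := by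
    have := ((hasDerivAt_pow 2 x).neg).div_const 4
    refine this.congr_deriv ?_
    push_cast
    ring
  refine ((p.hasDerivAt x).mul h1.exp).congr_deriv ?_
  simp only [Polynomial.eval_sub, Polynomial.eval_mul, Polynomial.eval_C, Polynomial.eval_X]
  ring

theorem exists_iteratedDeriv_poly_mul_gaussian (n : ℕ) (p : Polynomial ℝ) :
    ∃ q : Polynomial ℝ, iteratedDeriv n (fun x : ℝ => p.eval x * Real.exp (-x ^ 2 / 4)) =
      fun x : ℝ => q.eval x * Real.exp (-x ^ 2 / 4) := by
  induction n with
  | zero => exact ⟨p, by simp⟩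
  | succ n ih =>
    obtain ⟨q, hq⟩ := ih
    exact ⟨_, by rw [iteratedDeriv_succ, hq]; ext x; exact (hasDerivAt_poly_mul_gaussian q x).deriv⟩

/-- The Schwartz function `p(x) e^{-x²/4}`. -/
def polyGaussian (p : Polynomial ℝ) : 𝓢(ℝ, ℝ) where
  toFun x := p.eval x * Real.exp (-x ^ 2 / 4)
  smooth' := by
    apply ContDiff.mul
    · exact Polynomial.contDiff_aeval p _
    · fun_prop
  decay' := by
    intro k n
    obtain ⟨q, hq⟩ := exists_iteratedDeriv_poly_mul_gaussian n p
    obtain ⟨C, hC⟩ := exists_poly_mul_gaussian_le (Polynomial.X ^ k * q)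
    refine ⟨C, fun x => ?_⟩
    rw [norm_iteratedFDeriv_eq_norm_iteratedDeriv, hq, ← norm_pow, ← norm_mul, Real.norm_eq_abs]
    have := hC x
    rwa [Polynomial.eval_mul, Polynomial.eval_pow, Polynomial.eval_X, mul_assoc] at this

/-- The Hermite functions `h_n(x) = (√(2π) n!)^(-1/2) e^{-x²/4} H_n(x)`, where
`H_n(x) = (-1)^n e^{x²/2} (d/dx)^n e^{-x²/2}` are the (probabilists') Hermite polynomials. -/
def hermiteFun (n : ℕ) : 𝓢(ℝ, ℝ) :=
  (Real.sqrt (Real.sqrt (2 * Real.pi) * n.factorial))⁻¹ •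
    polyGaussian ((Polynomial.hermite n).map (Int.castRingHom ℝ))

theorem hermiteFun_apply (n : ℕ) (x : ℝ) :
    hermiteFun n x = (Real.sqrt (Real.sqrt (2 * Real.pi) * n.factorial))⁻¹ *
      Real.exp (-x ^ 2 / 4) * Polynomial.aeval x (Polynomial.hermite n) := by
  show (Real.sqrt (Real.sqrt (2 * Real.pi) * n.factorial))⁻¹ *
    (((Polynomial.hermite n).map (Int.castRingHom ℝ)).eval x * Real.exp (-x ^ 2 / 4)) = _
  rw [Polynomial.aeval_def, Polynomial.eval_map]
  simp only [algebraMap_int_eq]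
  ring

theorem derivS_polyGaussian (p : Polynomial ℝ) : derivS (polyGaussian p) =
    polyGaussian (p.derivative - Polynomial.C (1 / 2) * Polynomial.X * p) := by
  ext x
  exact (hasDerivAt_poly_mul_gaussian p x).deriv

/-- The creation operator `x/2 - d/dx`. -/
def raise (f : 𝓢(ℝ, ℝ)) : 𝓢(ℝ, ℝ) := (1 / 2 : ℝ) • mulX f - derivS f

theorem numberSucc_raise (f : 𝓢(ℝ, ℝ)) : numberSucc (raise f) = raise (numberSucc f + f) := by
  simp only [raise, map_sub, map_smul, map_add, numberSucc_mulX, numberSucc_derivS]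
  module

theorem raise_polyGaussian (n : ℕ) :
    raise (polyGaussian ((Polynomial.hermite n).map (Int.castRingHom ℝ))) =
      polyGaussian ((Polynomial.hermite (n + 1)).map (Int.castRingHom ℝ)) := by
  rw [raise, derivS_polyGaussian, Polynomial.hermite_succ]
  ext x
  rw [sub_apply, smul_apply, mulX_apply]
  show (1 / 2 : ℝ) • (x * (Polynomial.eval x _ * Real.exp (-x ^ 2 / 4))) -
    Polynomial.eval x _ * Real.exp (-x ^ 2 / 4) = Polynomial.eval x _ * Real.exp (-x ^ 2 / 4)
  simp
  ring

theorem norm_raise_sq (f : 𝓢(ℝ, ℝ)) :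
    ‖toL2 (raise f)‖ ^ 2 = inner ℝ (toL2 (numberSucc f)) (toL2 f) := by
  have h1 := inner_derivS f (mulX f)
  rw [derivS_mulX, map_add, inner_add_right, ← inner_mulX f (derivS f), real_inner_self_eq_norm_sq,
    real_inner_comm (toL2 (derivS f)) (toL2 (mulX f))] at h1
  rw [inner_numberSucc, raise, map_sub, map_smul, @norm_sub_sq_real, norm_smul, inner_smul_left]
  rw [real_inner_comm] at h1
  norm_num
  linarith

theorem numberSucc_hermite (n : ℕ) :
    numberSucc (polyGaussian ((Polynomial.hermite n).map (Int.castRingHom ℝ))) =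
      ((n : ℝ) + 1) • polyGaussian ((Polynomial.hermite n).map (Int.castRingHom ℝ)) := by
  induction n with
  | zero =>
    rw [numberSucc_apply, derivS_polyGaussian, derivS_polyGaussian]
    ext x
    rw [add_apply, add_apply, neg_apply,
      smul_apply, smul_apply, smul_apply, mulX_apply,
      mulX_apply]
    show -(Polynomial.eval x _ * Real.exp (-x ^ 2 / 4)) +
      (1 / 4 : ℝ) • (x * (x * (Polynomial.eval x _ * Real.exp (-x ^ 2 / 4)))) +
      (1 / 2 : ℝ) • (Polynomial.eval x _ * Real.exp (-x ^ 2 / 4)) =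
      (((0 : ℕ) : ℝ) + 1) • (Polynomial.eval x _ * Real.exp (-x ^ 2 / 4))
    simp
    ring
  | succ n ih =>
    rw [← raise_polyGaussian, numberSucc_raise, ih]
    simp only [raise, map_add, map_smul]
    push_cast
    module

theorem numberSucc_hermiteFun (n : ℕ) : numberSucc (hermiteFun n) = ((n : ℝ) + 1) • hermiteFun n := by
  rw [hermiteFun, map_smul, numberSucc_hermite, smul_comm]

theorem norm_hermiteFun (n : ℕ) : ‖toL2 (hermiteFun n)‖ = ‖toL2 (hermiteFun 0)‖ := by
  induction n with
  | zero => rfl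
  | succ n ih =>
    rw [← ih]
    set P := polyGaussian ((Polynomial.hermite n).map (Int.castRingHom ℝ)) with hP
    have h := norm_raise_sq P
    rw [numberSucc_hermite, map_smul, inner_smul_left, real_inner_self_eq_norm_sq,
      raise_polyGaussian, ← hP] at h
    simp only [conj_trivial] at h
    rw [hermiteFun, hermiteFun, map_smul, map_smul, norm_smul, norm_smul, ← hP]
    rw [← sq_eq_sq₀ (by positivity) (by positivity), mul_pow, mul_pow, h]
    simp only [norm_inv, Real.norm_eq_abs, sq_abs, inv_pow]
    rw [Real.sq_sqrt (by positivity), Real.sq_sqrt (by positivity), Nat.factorial_succ]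
    push_cast
    field_simp

theorem sNorm_hermiteFun (m n : ℕ) :
    sNorm m (hermiteFun n) = ((n : ℝ) + 1) ^ m * ‖toL2 (hermiteFun 0)‖ := by
  induction m with
  | zero => rw [sNorm_zero_eq, norm_hermiteFun]; simp
  | succ m ih =>
    rw [sNorm_succ, numberSucc_hermiteFun, sNorm_smul, ih, abs_of_pos (by positivity)]
    ring

/-! ### The tempered algebra -/

/-- The space `s` of rapidly decreasing real sequences. -/
def rapidSeq : Set (ℕ → ℝ) :=
  {a | ∀ m : ℕ, Summable fun n : ℕ => ((n : ℝ) + 1) ^ (2 * m) * |a n| ^ 2}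

/-- The space `s'` of real sequences of at most polynomial growth. -/
def slowSeq : Set (ℕ → ℝ) :=
  {b | ∃ (C : ℝ) (m : ℕ), ∀ n : ℕ, |b n| ≤ C * ((n : ℝ) + 1) ^ m}

theorem rapidSeq_mono {a b : ℕ → ℝ} (ha : a ∈ rapidSeq) (h : ∀ n, |b n| ≤ |a n|) :
    b ∈ rapidSeq := fun m =>
  (ha m).of_nonneg_of_le (fun n => by positivity) fun n => by
    have := h n
    gcongr

theorem rapidSeq_const_mul {a : ℕ → ℝ} (ha : a ∈ rapidSeq) (c : ℝ) :
    (fun n => c * a n) ∈ rapidSeq := fun m => by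
  refine ((ha m).mul_left (|c| ^ 2)).congr fun n => ?_
  rw [abs_mul, mul_pow]
  ring

theorem rapidSeq_add {a b : ℕ → ℝ} (ha : a ∈ rapidSeq) (hb : b ∈ rapidSeq) :
    (fun n => a n + b n) ∈ rapidSeq := fun m => by
  refine (((ha m).add (hb m)).mul_left 2).of_nonneg_of_le (fun n => by positivity) fun n => ?_
  rw [← mul_add, mul_left_comm]
  refine mul_le_mul_of_nonneg_left ?_ (by positivity)
  rw [sq_abs, sq_abs, sq_abs]
  nlinarith [sq_nonneg (a n - b n)]

theorem slowSeq_mono {a b : ℕ → ℝ} (ha : a ∈ slowSeq) (h : ∀ n, |b n| ≤ |a n|) :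
    b ∈ slowSeq := by
  obtain ⟨C, m, hC⟩ := ha
  exact ⟨C, m, fun n => (h n).trans (hC n)⟩

theorem slowSeq_const_mul {a : ℕ → ℝ} (ha : a ∈ slowSeq) (c : ℝ) :
    (fun n => c * a n) ∈ slowSeq := by
  obtain ⟨C, m, hC⟩ := ha
  refine ⟨|c| * C, m, fun n => ?_⟩
  rw [abs_mul, mul_assoc]
  exact mul_le_mul_of_nonneg_left (hC n) (abs_nonneg c)

theorem slowSeq_add {a b : ℕ → ℝ} (ha : a ∈ slowSeq) (hb : b ∈ slowSeq) :
    (fun n => a n + b n) ∈ slowSeq := by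
  obtain ⟨C, m, hC⟩ := ha
  obtain ⟨C', m', hC'⟩ := hb
  refine ⟨|C| + |C'|, m + m', fun n => (abs_add_le _ _).trans ?_⟩
  have h1 : (1 : ℝ) ≤ (n : ℝ) + 1 := by linarith [n.cast_nonneg (α := ℝ)]
  have e1 : ((n : ℝ) + 1) ^ m ≤ ((n : ℝ) + 1) ^ (m + m') := pow_le_pow_right₀ h1 (by omega)
  have e2 : ((n : ℝ) + 1) ^ m' ≤ ((n : ℝ) + 1) ^ (m + m') := pow_le_pow_right₀ h1 (by omega)
  have d1 : C * ((n : ℝ) + 1) ^ m ≤ |C| * ((n : ℝ) + 1) ^ (m + m') :=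
    mul_le_mul (le_abs_self C) e1 (by positivity) (abs_nonneg C)
  have d2 : C' * ((n : ℝ) + 1) ^ m' ≤ |C'| * ((n : ℝ) + 1) ^ (m + m') :=
    mul_le_mul (le_abs_self C') e2 (by positivity) (abs_nonneg C')
  linarith [hC n, hC' n]

/-- `𝓗_{s'}`: sequences `(f_n)` in `𝓢` with `(‖f_n‖_m) ∈ s'` for every `m`. -/
def moderate : Submodule ℝ (ℕ → 𝓢(ℝ, ℝ)) where
  carrier := {f | ∀ m : ℕ, (fun n => sNorm m (f n)) ∈ slowSeq}
  zero_mem' := fun m => ⟨0, 0, fun n => by simp [sNorm_zero]⟩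
  add_mem' := fun {f g} hf hg m => slowSeq_mono (slowSeq_add (hf m) (hg m)) fun n => by
    rw [abs_of_nonneg (sNorm_nonneg _ _),
      abs_of_nonneg (add_nonneg (sNorm_nonneg _ _) (sNorm_nonneg _ _))]
    exact sNorm_add _ _ _
  smul_mem' := fun c f hf m => slowSeq_mono (slowSeq_const_mul (hf m) c) fun n => by
    rw [Pi.smul_apply, sNorm_smul, abs_mul, abs_mul, abs_abs]

/-- `𝓗_s`: sequences `(f_n)` in `𝓢` with `(‖f_n‖_m) ∈ s` for every `m`. -/
def negligible : Submodule ℝ (ℕ → 𝓢(ℝ, ℝ)) where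
  carrier := {f | ∀ m : ℕ, (fun n => sNorm m (f n)) ∈ rapidSeq}
  zero_mem' := fun m k => by simp [sNorm_zero]
  add_mem' := fun {f g} hf hg m => rapidSeq_mono (rapidSeq_add (hf m) (hg m)) fun n => by
    rw [abs_of_nonneg (sNorm_nonneg _ _),
      abs_of_nonneg (add_nonneg (sNorm_nonneg _ _) (sNorm_nonneg _ _))]
    exact sNorm_add _ _ _
  smul_mem' := fun c f hf m => rapidSeq_mono (rapidSeq_const_mul (hf m) c) fun n => by
    rw [Pi.smul_apply, sNorm_smul, abs_mul, abs_mul, abs_abs]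

theorem negligible_le_moderate : negligible ≤ moderate := fun f hf m => by
  have h0 := hf m 0
  refine ⟨Real.sqrt (∑' n : ℕ, ((n : ℝ) + 1) ^ (2 * 0) * |sNorm m (f n)| ^ 2), 0, fun n => ?_⟩
  rw [pow_zero, mul_one]
  refine Real.le_sqrt_of_sq_le ?_
  have h1 := h0.le_tsum n fun j _ => by positivity
  refine le_trans (le_of_eq ?_) h1
  rw [mul_zero, pow_zero, one_mul]

/-- The space `𝓗 = 𝓗_{s'} / 𝓗_s` of tempered generalized functions, with its linear structure. -/
abbrev TemperedGF : Type := moderate ⧸ negligible.submoduleOf moderate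

/-- The class `[f_n]` of a moderate sequence. -/
def cls (f : moderate) : TemperedGF := Submodule.Quotient.mk f

theorem map_mem_moderate (A : 𝓢(ℝ, ℝ) →L[ℝ] 𝓢(ℝ, ℝ)) {f : ℕ → 𝓢(ℝ, ℝ)} (hf : f ∈ moderate) :
    (fun n => A (f n)) ∈ moderate := fun m => by
  obtain ⟨r, C, hC, h⟩ := exists_sNorm_map_le A m
  refine slowSeq_mono (slowSeq_const_mul (hf r) C) fun n => ?_
  rw [abs_of_nonneg (sNorm_nonneg _ _), abs_of_nonneg (mul_nonneg hC (sNorm_nonneg _ _))]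
  exact h _

theorem map_mem_negligible (A : 𝓢(ℝ, ℝ) →L[ℝ] 𝓢(ℝ, ℝ)) {f : ℕ → 𝓢(ℝ, ℝ)}
    (hf : f ∈ negligible) : (fun n => A (f n)) ∈ negligible := fun m => by
  obtain ⟨r, C, hC, h⟩ := exists_sNorm_map_le A m
  refine rapidSeq_mono (rapidSeq_const_mul (hf r) C) fun n => ?_
  rw [abs_of_nonneg (sNorm_nonneg _ _), abs_of_nonneg (mul_nonneg hC (sNorm_nonneg _ _))]
  exact h _

/-- A continuous linear operator `A` of `𝓢` acts on `𝓗` by `A [f_n] = [A f_n]`. -/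
def liftOp (A : 𝓢(ℝ, ℝ) →L[ℝ] 𝓢(ℝ, ℝ)) : TemperedGF →ₗ[ℝ] TemperedGF :=
  Submodule.mapQ _ _
    ((A.toLinearMap.compLeft ℕ).restrict (p := moderate) (q := moderate)
      fun _ hf => map_mem_moderate A hf)
    fun _ hf => map_mem_negligible A hf

theorem liftOp_cls (A : 𝓢(ℝ, ℝ) →L[ℝ] 𝓢(ℝ, ℝ)) (f : moderate) :
    liftOp A (cls f) = cls ⟨fun n => A (f.1 n), map_mem_moderate A f.2⟩ := rfl

/-- The derivative `D [f_n] = [D f_n]` on `𝓗`. -/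
def D : TemperedGF →ₗ[ℝ] TemperedGF := liftOp derivS

/-- The multipliers `𝓞_M` of `𝓢`: real smooth functions on the line, each of whose derivatives is
bounded by a polynomial. -/
abbrev OM : Type := {l : ℝ → ℝ // l.HasTemperateGrowth}

/-- The product `l [f_n] = [l f_n]` of `l ∈ 𝓞_M` and an element of `𝓗`. -/
instance : SMul OM TemperedGF := ⟨fun l u => liftOp (SchwartzMap.smulLeftCLM ℝ l.1) u⟩

/-- The action of `𝓞_M` on classes, `l [f_n] = [l f_n]`. -/
theorem OM_smul_cls (l : OM) (f g : moderate) (h : ∀ n x, g.1 n x = l.1 x * f.1 n x) :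
    l • cls f = cls g := by
  show cls _ = cls _
  congr 1
  ext n x
  show SchwartzMap.smulLeftCLM ℝ l.1 (f.1 n) x = _
  rw [SchwartzMap.smulLeftCLM_apply_apply l.2, h, smul_eq_mul]

theorem pairing_tendsto_zero {f : ℕ → 𝓢(ℝ, ℝ)} (hf : f ∈ negligible) (φ : 𝓢(ℝ, ℝ)) :
    Tendsto (fun n => ∫ x, f n x * φ x) atTop (𝓝 0) := by
  have h0 : Tendsto (fun n => sNorm 0 (f n)) atTop (𝓝 0) := by
    have := (hf 0 0).tendsto_atTop_zero
    simp only [mul_zero, pow_zero, one_mul, sq_abs] at this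
    have h2 := (Real.continuous_sqrt.tendsto 0).comp this
    simp only [Real.sqrt_zero] at h2
    exact h2.congr fun n => Real.sqrt_sq (sNorm_nonneg _ _)
  refine squeeze_zero_norm (fun n => ?_) (by simpa using h0.mul_const ‖toL2 φ‖)
  rw [← inner_toL2, sNorm_zero_eq]
  exact norm_inner_le_norm _ _

/-- Association in `𝓗`: `[f_n] ≈ [g_n]` if `∫ (f_n - g_n) φ dx → 0` for all `φ ∈ 𝓢`. -/
def Assoc (u v : TemperedGF) : Prop :=
  Quotient.liftOn₂' u v
    (fun f g => ∀ φ : 𝓢(ℝ, ℝ),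
      Tendsto (fun n => ∫ x, (f.1 n - g.1 n) x * φ x) atTop (𝓝 0))
    (by
      have key : ∀ f g f' g' : moderate, f.1 - f'.1 ∈ negligible → g.1 - g'.1 ∈ negligible →
          (∀ φ : 𝓢(ℝ, ℝ), Tendsto (fun n => ∫ x, (f.1 n - g.1 n) x * φ x) atTop (𝓝 0)) →
          ∀ φ : 𝓢(ℝ, ℝ), Tendsto (fun n => ∫ x, (f'.1 n - g'.1 n) x * φ x) atTop (𝓝 0) := by
        intro f g f' g' hf hg h φ
        have h1 := ((h φ).sub (pairing_tendsto_zero hf φ)).add (pairing_tendsto_zero hg φ)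
        simp only [sub_zero, add_zero] at h1
        refine h1.congr fun n => ?_
        simp only [← inner_toL2, ← inner_sub_left, ← inner_add_left, ← map_sub, ← map_add]
        congr 2
        simp only [Pi.sub_apply]
        abel
      intro f g f' g' hf hg
      have hf' : f.1 - f'.1 ∈ negligible := (Submodule.quotientRel_def (negligible.submoduleOf moderate)).1 hf
      have hg' : g.1 - g'.1 ∈ negligible := (Submodule.quotientRel_def (negligible.submoduleOf moderate)).1 hg
      refine propext ⟨key f g f' g' hf' hg', key f' g' f g ?_ ?_⟩
      · rw [← neg_sub]; exact negligible.neg_mem hf'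
      · rw [← neg_sub]; exact negligible.neg_mem hg')

theorem assoc_cls_iff (f g : moderate) : Assoc (cls f) (cls g) ↔
    ∀ φ : 𝓢(ℝ, ℝ), Tendsto (fun n => ∫ x, (f.1 n - g.1 n) x * φ x) atTop (𝓝 0) := Iff.rfl

/-! ### The embedding of the tempered distributions -/

/-- The space `𝓢'` of (real) tempered distributions: continuous linear functionals on `𝓢`. -/
abbrev TempDist : Type := 𝓢(ℝ, ℝ) →L[ℝ] ℝ

/-- The partial sums `T_n = ∑_{j ≤ n} T(h_j) h_j`. -/
def hermiteSum (T : TempDist) (n : ℕ) : 𝓢(ℝ, ℝ) :=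
  ∑ j ∈ Finset.range (n + 1), T (hermiteFun j) • hermiteFun j

theorem hermiteSum_mem (T : TempDist) : hermiteSum T ∈ moderate := fun m => by
  obtain ⟨r, C, hC, h⟩ := exists_abs_apply_le T
  set c := ‖toL2 (hermiteFun 0)‖ with hc
  refine ⟨C * c * c, r + m + 1, fun n => ?_⟩
  rw [abs_of_nonneg (sNorm_nonneg _ _)]
  refine (sNorm_sum m _ _).trans ?_
  have hb : ∀ j ∈ Finset.range (n + 1), sNorm m (T (hermiteFun j) • hermiteFun j) ≤
      C * c * c * ((n : ℝ) + 1) ^ (r + m) := by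
    intro j hj
    have hjn : (j : ℝ) + 1 ≤ (n : ℝ) + 1 := by
      have : j ≤ n := by simpa [Nat.lt_succ_iff] using hj
      exact_mod_cast Nat.succ_le_succ this
    have h1 := h (hermiteFun j)
    rw [sNorm_hermiteFun] at h1
    rw [sNorm_smul, sNorm_hermiteFun]
    calc |T (hermiteFun j)| * (((j : ℝ) + 1) ^ m * c)
        ≤ (C * (((j : ℝ) + 1) ^ r * c)) * (((j : ℝ) + 1) ^ m * c) := by gcongr
      _ = C * c * c * ((j : ℝ) + 1) ^ (r + m) := by rw [pow_add]; ring
      _ ≤ _ := by gcongr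
  refine (Finset.sum_le_sum hb).trans (le_of_eq ?_)
  rw [Finset.sum_const, Finset.card_range, nsmul_eq_mul, pow_succ]
  push_cast
  ring

/-- The embedding `ι : 𝓢' → 𝓗`, `ι(T) = [T_n]`. -/
def iota (T : TempDist) : TemperedGF := cls ⟨hermiteSum T, hermiteSum_mem T⟩

end TemperedAlgebra

end

/-!
Association is tested by the pairing `∫ f φ`, for which `D` has the transpose `-D` and
multiplication by `l ∈ 𝓞_M` is its own transpose. Moving the operator to the test function
(`Assoc.liftOp`) shows that both preserve association.

For the injectivity of `ι` modulo association, let `ι(T) ≈ ι(S)`. Since the `h_j` are orthonormal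
(they are normalised eigenvectors of the symmetric operator `N + 1` for distinct eigenvalues),
`∫ (T_n - S_n) h_k = T(h_k) - S(h_k)` as soon as `n ≥ k`, so `T` and `S` agree on all Hermite
functions. It remains to see that a tempered distribution which kills the `h_j` is zero
(`eq_zero_of_hermiteFun`). The Hermite functions form a Hilbert basis of `L²` (`hermiteBasis`), and
`N + 1` commutes with the partial sums of Hermite expansions; hence the expansion of `φ ∈ 𝓢`
converges to `φ` in every norm `‖·‖_m`, and these norms control every tempered distribution.

Completeness of the Hermite functions is a moment problem: if `f ∈ L²` is orthogonal to all of them,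
then all moments of `g(x) = f(x) e^{-x²/4}` vanish. As `g` is integrable against every `e^{a|x|}`,
its Fourier transform may be expanded in moments (`integral_mul_cexp_eq_zero_of_moments`), so it
vanishes, and `g = 0` by Fourier inversion on `𝓢` (`ae_eq_zero_of_fourier_eq_zero`).
-/

noncomputable section

namespace TemperedAlgebra

open scoped FourierTransform ContDiff

/-! ### Functions of exponential decay are determined by their moments -/

/-- The exponential series is integrated term by term, with dominating function
`e^{|t||x|} |g(x)|`. -/
theorem integral_mul_cexp_eq_zero_of_moments {g : ℝ → ℝ}
    (hg : ∀ a : ℝ, Integrable fun x => Real.exp (a * |x|) * g x)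
    (hm : ∀ n : ℕ, ∫ x, x ^ n * g x = 0) (t : ℝ) :
    ∫ x, Complex.exp (↑(t * x) * Complex.I) * (g x : ℂ) = 0 := by
  have hg0 : AEStronglyMeasurable g := by simpa using (hg 0).aestronglyMeasurable
  have hexp : ∀ x : ℝ, HasSum (fun n : ℕ => (|t| * |x|) ^ n / n.factorial * |g x|)
      (Real.exp (|t| * |x|) * |g x|) := fun x => by
    rw [Real.exp_eq_exp_ℝ]
    exact (NormedSpace.expSeries_div_hasSum_exp (|t| * |x|)).mul_right _
  have hcexp : ∀ x : ℝ, HasSum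
      (fun n : ℕ => (↑(t * x) * Complex.I) ^ n / n.factorial * (g x : ℂ))
      (Complex.exp (↑(t * x) * Complex.I) * (g x : ℂ)) := fun x => by
    have h := NormedSpace.expSeries_div_hasSum_exp (𝔸 := ℂ) (↑(t * x) * Complex.I)
    rw [← Complex.exp_eq_exp_ℂ] at h
    exact h.mul_right (g x : ℂ)
  have hmeas : ∀ n : ℕ, AEStronglyMeasurable
      (fun x : ℝ => (↑(t * x) * Complex.I) ^ n / n.factorial * (g x : ℂ)) := fun n =>
    (by fun_prop : Continuous fun x : ℝ =>
      (↑(t * x) * Complex.I) ^ n / (n.factorial : ℂ)).aestronglyMeasurable.mul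
        (Complex.continuous_ofReal.comp_aestronglyMeasurable hg0)
  have hbound : ∀ (n : ℕ) (x : ℝ), ‖(↑(t * x) * Complex.I) ^ n / n.factorial * (g x : ℂ)‖ ≤
      (|t| * |x|) ^ n / n.factorial * |g x| := fun n x => by simp
  have hint : Integrable fun x : ℝ => ∑' n : ℕ, (|t| * |x|) ^ n / n.factorial * |g x| := by
    simp_rw [fun x => (hexp x).tsum_eq]
    refine (hg |t|).norm.congr (Eventually.of_forall fun x => ?_)
    simp
  have key := hasSum_integral_of_dominated_convergence _ hmeas
    (fun n => Eventually.of_forall (hbound n)) (Eventually.of_forall fun x => (hexp x).summable)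
    hint (Eventually.of_forall hcexp)
  refine key.unique ?_
  convert! hasSum_zero (α := ℂ) (β := ℕ) using 2 with n
  have e : ∀ x : ℝ, (↑(t * x) * Complex.I) ^ n / n.factorial * (g x : ℂ) =
      ((t * Complex.I) ^ n / n.factorial) * ((x ^ n * g x : ℝ) : ℂ) := fun x => by
    push_cast
    ring
  simp_rw [e]
  rw [integral_const_mul, integral_complex_ofReal, hm]
  simp

/-- An integrable function whose Fourier transform vanishes is orthogonal to every Schwartz
function, since the latter are themselves Fourier transforms. -/
theorem ae_eq_zero_of_fourier_eq_zero {G : ℝ → ℂ} (hG : Integrable G)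
    (h : ∀ w, 𝓕 G w = 0) : G =ᵐ[volume] 0 := by
  refine ae_eq_zero_of_integral_contDiff_smul_eq_zero hG.locallyIntegrable fun φ hφ hc => ?_
  have hc' : HasCompactSupport (Complex.ofRealCLM ∘ φ) := hc.comp_left rfl
  have hφ' : ContDiff ℝ ∞ (Complex.ofRealCLM ∘ φ) := by fun_prop
  obtain ⟨ξ, hξ⟩ : ∃ ξ : 𝓢(ℝ, ℂ), 𝓕 ξ = hc'.toSchwartzMap hφ' :=
    ⟨𝓕⁻ (hc'.toSchwartzMap hφ'), FourierTransform.fourier_fourierInv_eq _⟩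
  have key : ∫ w, 𝓕 G w • ξ w = ∫ x, G x • 𝓕 (ξ : ℝ → ℂ) x := by
    have := VectorFourier.integral_fourierIntegral_smul_eq_flip (L := innerₗ ℝ) (μ := volume)
      (ν := volume) Real.continuous_fourierChar continuous_inner hG ξ.integrable
    rwa [flip_innerₗ] at this
  rw [← SchwartzMap.fourier_coe, hξ] at key
  simp only [h, zero_smul, integral_zero] at key
  rw [key]
  congr 1; ext x
  simp [mul_comm]

theorem ae_eq_zero_of_moments {g : ℝ → ℝ}
    (hg : ∀ a : ℝ, Integrable fun x => Real.exp (a * |x|) * g x)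
    (hm : ∀ n : ℕ, ∫ x, x ^ n * g x = 0) : g =ᵐ[volume] 0 := by
  have hgi : Integrable g := by simpa using hg 0
  have h0 := ae_eq_zero_of_fourier_eq_zero hgi.ofReal fun w => by
    rw [Real.fourier_real_eq_integral_exp_smul,
      ← integral_mul_cexp_eq_zero_of_moments hg hm (-2 * Real.pi * w)]
    congr 1; ext x
    rw [smul_eq_mul, mul_right_comm (-2 * Real.pi)]
    rfl
  filter_upwards [h0] with x hx
  exact Complex.ofReal_eq_zero.1 hx

/-! ### Completeness of the Hermite functions -/

theorem integrable_exp_mul_gaussian {f : ℝ → ℝ} (hf : MemLp f 2) (a : ℝ) :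
    Integrable fun x => Real.exp (a * |x|) * (f x * Real.exp (-x ^ 2 / 4)) := by
  have hE : MemLp (fun x : ℝ => Real.exp (a * |x|) * Real.exp (-x ^ 2 / 4)) 2 := by
    rw [memLp_two_iff_integrable_sq (by fun_prop)]
    refine ((integrable_exp_neg_mul_sq (b := 1 / 4) (by norm_num)).const_mul
      (Real.exp (4 * a ^ 2))).mono' (by fun_prop) (Eventually.of_forall fun x => ?_)
    rw [Real.norm_eq_abs, abs_of_nonneg (by positivity), ← Real.exp_add, ← Real.exp_add,
      ← Real.exp_nat_mul, Real.exp_le_exp]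
    push_cast
    -- `2a|x| ≤ 4a² + x²/4` by completing the square
    nlinarith [sq_nonneg (2 * a - |x| / 2), sq_abs x]
  refine (hE.integrable_mul hf).congr (Eventually.of_forall fun x => ?_)
  simp only [Pi.mul_apply]
  ring

/-- The variant of `inner_toL2` in which only one factor is a Schwartz function. -/
theorem inner_toL2_left (f : 𝓢(ℝ, ℝ)) (g : Lp ℝ 2 (volume : Measure ℝ)) :
    inner ℝ (toL2 f) g = ∫ x, f x * g x := by
  apply integral_congr_ae
  filter_upwards [f.coeFn_toLp 2 volume] with x hf
  show inner ℝ ((f.toLp 2 volume : ℝ → ℝ) x) (g x) = _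
  rw [hf]
  simp [mul_comm]

theorem eq_zero_of_inner_polyGaussian {f : Lp ℝ 2 (volume : Measure ℝ)}
    (h : ∀ p, inner ℝ (toL2 (polyGaussian p)) f = 0) : f = 0 := by
  have h0 : (fun x => f x * Real.exp (-x ^ 2 / 4)) =ᵐ[volume] 0 := by
    refine ae_eq_zero_of_moments (integrable_exp_mul_gaussian (Lp.memLp f)) fun n => ?_
    rw [← h (Polynomial.X ^ n), inner_toL2_left]
    congr 1; ext x
    show _ = (Polynomial.eval x (Polynomial.X ^ n) * Real.exp (-x ^ 2 / 4)) * f x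
    rw [Polynomial.eval_pow, Polynomial.eval_X]
    ring
  rw [Lp.eq_zero_iff_ae_eq_zero]
  filter_upwards [h0] with x hx
  simpa using hx

/-- The Hermite polynomials, one of each degree, with real coefficients. -/
def hermiteSeq : Polynomial.Sequence ℝ where
  elems' n := (Polynomial.hermite n).map (Int.castRingHom ℝ)
  degree_eq' n := by
    rw [(Polynomial.hermite_monic n).degree_map, Polynomial.degree_hermite]

/-- The Hermite polynomials span all polynomials, having one element in each degree. -/
theorem polyGaussian_mem_span (p : Polynomial ℝ) :
    polyGaussian p ∈ Submodule.span ℝ (Set.range hermiteFun) := by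
  have hp : p ∈ Submodule.span ℝ (Set.range hermiteSeq) := by
    rw [hermiteSeq.span fun i => ?_]
    · trivial
    · exact isUnit_iff_ne_zero.2 (Polynomial.leadingCoeff_ne_zero.2 (hermiteSeq.ne_zero i))
  induction hp using Submodule.span_induction with
  | mem p hp =>
    obtain ⟨n, rfl⟩ := hp
    have hc : Real.sqrt (Real.sqrt (2 * Real.pi) * n.factorial) ≠ 0 := by positivity
    have : polyGaussian (hermiteSeq n) =
        Real.sqrt (Real.sqrt (2 * Real.pi) * n.factorial) • hermiteFun n := by
      rw [hermiteFun, smul_inv_smul₀ hc]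
      rfl
    rw [this]
    exact Submodule.smul_mem _ _ (Submodule.subset_span ⟨n, rfl⟩)
  | zero =>
    convert! Submodule.zero_mem _
    ext x
    show Polynomial.eval x 0 * _ = 0
    simp
  | add p q _ _ hp hq =>
    convert! Submodule.add_mem _ hp hq
    ext x
    show Polynomial.eval x (p + q) * _ = Polynomial.eval x p * _ + Polynomial.eval x q * _
    rw [Polynomial.eval_add, add_mul]
  | smul c p _ hp =>
    convert! Submodule.smul_mem _ c hp
    ext x
    show Polynomial.eval x (c • p) * _ = c * (Polynomial.eval x p * _)
    rw [Polynomial.eval_smul, smul_eq_mul, mul_assoc]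

theorem inner_numberSucc_left (f g : 𝓢(ℝ, ℝ)) :
    inner ℝ (toL2 (numberSucc f)) (toL2 g) = inner ℝ (toL2 f) (toL2 (numberSucc g)) := by
  simp only [numberSucc_apply, map_add, map_neg, map_smul, inner_add_left, inner_neg_left,
    inner_smul_left, inner_add_right, inner_neg_right, inner_smul_right, inner_derivS, inner_mulX]
  simp

theorem inner_numberSucc_pow_left (m : ℕ) (f g : 𝓢(ℝ, ℝ)) :
    inner ℝ (toL2 ((numberSucc ^ m) f)) (toL2 g) =
      inner ℝ (toL2 f) (toL2 ((numberSucc ^ m) g)) := by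
  induction m generalizing g with
  | zero => rfl
  | succ m ih =>
    calc _ = inner ℝ (toL2 (numberSucc ((numberSucc ^ m) f))) (toL2 g) := by rw [pow_succ']; rfl
      _ = inner ℝ (toL2 f) (toL2 ((numberSucc ^ m) (numberSucc g))) := by
        rw [inner_numberSucc_left, ih]
      _ = _ := by rw [pow_succ]; rfl

theorem numberSucc_pow_hermiteFun (m n : ℕ) :
    (numberSucc ^ m) (hermiteFun n) = ((n : ℝ) + 1) ^ m • hermiteFun n := by
  induction m with
  | zero => simp
  | succ m ih =>
    rw [pow_succ]
    show (numberSucc ^ m) (numberSucc (hermiteFun n)) = _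
    rw [numberSucc_hermiteFun, map_smul, ih, smul_smul, pow_succ']

theorem norm_toL2_hermiteFun (n : ℕ) : ‖toL2 (hermiteFun n)‖ = 1 := by
  rw [norm_hermiteFun, ← sq_eq_sq₀ (norm_nonneg _) zero_le_one, ← real_inner_self_eq_norm_sq,
    inner_toL2]
  have e : ∀ x : ℝ, hermiteFun 0 x * hermiteFun 0 x =
      (Real.sqrt (2 * Real.pi))⁻¹ * Real.exp (-(1 / 2) * x ^ 2) := fun x => by
    rw [hermiteFun_apply]
    simp only [Polynomial.hermite_zero, Nat.factorial_zero]
    rw [show -(1 / 2) * x ^ 2 = -x ^ 2 / 4 + -x ^ 2 / 4 by ring, Real.exp_add]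
    have : (Real.sqrt (Real.sqrt (2 * Real.pi)))⁻¹ * (Real.sqrt (Real.sqrt (2 * Real.pi)))⁻¹ =
        (Real.sqrt (2 * Real.pi))⁻¹ := by
      rw [← mul_inv, Real.mul_self_sqrt (by positivity)]
    rw [← this]
    simp only [map_one, Nat.cast_one, mul_one]
    ring
  simp_rw [e]
  rw [integral_const_mul, integral_gaussian, show Real.pi / (1 / 2) = 2 * Real.pi by ring,
    inv_mul_cancel₀ (by positivity), one_pow]

theorem orthonormal_hermiteFun : Orthonormal ℝ fun n => toL2 (hermiteFun n) := by
  refine ⟨norm_toL2_hermiteFun, fun i j hij => ?_⟩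
  -- eigenvectors of a symmetric operator for distinct eigenvalues
  have h := inner_numberSucc_left (hermiteFun i) (hermiteFun j)
  rw [numberSucc_hermiteFun, numberSucc_hermiteFun, map_smul, map_smul, inner_smul_left,
    inner_smul_right, conj_trivial, ← sub_eq_zero, ← sub_mul] at h
  refine (mul_eq_zero.1 h).resolve_left fun h' => hij ?_
  exact_mod_cast (by linarith : (i : ℝ) = j)

/-- The Hermite functions as a Hilbert basis of `L²(ℝ)`. -/
def hermiteBasis : HilbertBasis ℕ ℝ (Lp ℝ 2 (volume : Measure ℝ)) :=
  HilbertBasis.mkOfOrthogonalEqBot orthonormal_hermiteFun (by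
    rw [Submodule.eq_bot_iff]
    intro f hf
    refine eq_zero_of_inner_polyGaussian fun p => hf _ ?_
    have := Submodule.mem_map_of_mem (f := toL2.toLinearMap) (polyGaussian_mem_span p)
    rw [Submodule.map_span, ← Set.range_comp] at this
    exact this)

theorem hermiteBasis_apply (n : ℕ) : hermiteBasis n = toL2 (hermiteFun n) := by
  rw [hermiteBasis, HilbertBasis.coe_mkOfOrthogonalEqBot]

/-! ### Hermite expansions converge in the Schwartz space -/

/-- The partial sums `∑_{j < n} ⟨h_j, φ⟩ h_j` of the Hermite expansion of `φ`,
as Schwartz functions. -/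
def hermitePartialSum (φ : 𝓢(ℝ, ℝ)) (n : ℕ) : 𝓢(ℝ, ℝ) :=
  ∑ j ∈ Finset.range n, inner ℝ (toL2 (hermiteFun j)) (toL2 φ) • hermiteFun j

/-- The operator `N + 1` commutes with the partial sums of Hermite expansions. -/
theorem numberSucc_pow_hermitePartialSum (m : ℕ) (φ : 𝓢(ℝ, ℝ)) (n : ℕ) :
    (numberSucc ^ m) (hermitePartialSum φ n) = hermitePartialSum ((numberSucc ^ m) φ) n := by
  simp only [hermitePartialSum, map_sum, map_smul]
  refine Finset.sum_congr rfl fun j _ => ?_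
  rw [← inner_numberSucc_pow_left, numberSucc_pow_hermiteFun, map_smul, inner_smul_left,
    conj_trivial, smul_smul, mul_comm]

/-- The norm `‖·‖_m` of the remainder for `φ` is the `L²` norm of the remainder for
`(N + 1)^m φ`. -/
theorem tendsto_sNorm_sub_hermitePartialSum (m : ℕ) (φ : 𝓢(ℝ, ℝ)) :
    Tendsto (fun n => sNorm m (hermitePartialSum φ n - φ)) atTop (𝓝 0) := by
  have h := (hermiteBasis.hasSum_repr (toL2 ((numberSucc ^ m) φ))).tendsto_sum_nat
  refine (tendsto_iff_norm_sub_tendsto_zero.1 h).congr fun n => ?_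
  rw [sNorm_eq, map_sub, numberSucc_pow_hermitePartialSum, map_sub]
  simp only [hermitePartialSum, map_sum, map_smul, HilbertBasis.repr_apply_apply,
    hermiteBasis_apply]

/-- A tempered distribution is determined by its values on the Hermite functions. -/
theorem eq_zero_of_hermiteFun (T : TempDist) (h : ∀ j, T (hermiteFun j) = 0) : T = 0 := by
  ext φ
  obtain ⟨r, C, -, hT⟩ := exists_abs_apply_le T
  have h1 : ∀ n, |T φ| ≤ C * sNorm r (hermitePartialSum φ n - φ) := fun n => by
    have := hT (hermitePartialSum φ n - φ)
    rw [map_sub, hermitePartialSum, map_sum] at this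
    simpa [h, hermitePartialSum] using this
  have h2 := ge_of_tendsto' ((tendsto_sNorm_sub_hermitePartialSum r φ).const_mul C) h1
  rw [mul_zero] at h2
  exact abs_nonpos_iff.1 h2

/-! ### Association -/

/-- An operator of `𝓢` with a transpose for the pairing `∫ f φ` preserves association: the
transpose moves the operator to the test function. -/
theorem Assoc.liftOp {A B : 𝓢(ℝ, ℝ) →L[ℝ] 𝓢(ℝ, ℝ)}
    (hAB : ∀ f φ, ∫ x, A f x * φ x = ∫ x, f x * B φ x) {u v : TemperedGF} (h : Assoc u v) :
    Assoc (liftOp A u) (liftOp A v) := by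
  induction u using Submodule.Quotient.induction_on with | H f => ?_
  induction v using Submodule.Quotient.induction_on with | H g => ?_
  intro φ
  refine (h (B φ)).congr fun n => ?_
  rw [← hAB, map_sub]
  rfl

theorem Assoc.D {u v : TemperedGF} (h : Assoc u v) : Assoc (D u) (D v) := by
  refine h.liftOp (B := -derivS) fun f φ => ?_
  rw [← inner_toL2, ← inner_toL2, inner_derivS, neg_apply, map_neg, inner_neg_right]

theorem Assoc.OM_smul {u v : TemperedGF} (h : Assoc u v) (l : OM) : Assoc (l • u) (l • v) := by
  refine h.liftOp (B := SchwartzMap.smulLeftCLM ℝ l.1) fun f φ => ?_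
  congr 1; ext x
  rw [SchwartzMap.smulLeftCLM_apply_apply l.2, SchwartzMap.smulLeftCLM_apply_apply l.2,
    smul_eq_mul, smul_eq_mul]
  ring

theorem inner_hermiteSum (T : TempDist) {n k : ℕ} (hk : k ≤ n) :
    inner ℝ (toL2 (hermiteSum T n)) (toL2 (hermiteFun k)) = T (hermiteFun k) := by
  rw [hermiteSum, map_sum]
  simp only [map_smul]
  have := orthonormal_hermiteFun.inner_left_sum (fun j => T (hermiteFun j))
    (Finset.mem_range.2 (Nat.lt_succ_of_le hk))
  simpa using this

theorem eq_of_assoc_iota {T S : TempDist} (h : Assoc (iota T) (iota S)) : T = S := by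
  rw [← sub_eq_zero]
  refine eq_zero_of_hermiteFun _ fun k => ?_
  have h1 := (assoc_cls_iff _ _).1 h (hermiteFun k)
  -- testing against `h_k` leaves the `k`-th coefficient, constant in `n ≥ k`
  refine tendsto_nhds_unique (tendsto_const_nhds.congr' ?_) h1
  filter_upwards [eventually_ge_atTop k] with n hn
  rw [← inner_toL2, map_sub, inner_sub_left, inner_hermiteSum T hn, inner_hermiteSum S hn,
    sub_apply]

end TemperedAlgebra

end

theorem mainTheorem9 :
    (∀ u v : TemperedAlgebra.TemperedGF, TemperedAlgebra.Assoc u v →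
      ∀ α : ℕ, TemperedAlgebra.Assoc ((TemperedAlgebra.D ^ α) u) ((TemperedAlgebra.D ^ α) v)) ∧
    (∀ u v : TemperedAlgebra.TemperedGF, TemperedAlgebra.Assoc u v →
      ∀ l : TemperedAlgebra.OM, TemperedAlgebra.Assoc (l • u) (l • v)) ∧
    (∀ T S : TemperedAlgebra.TempDist,
      TemperedAlgebra.Assoc (TemperedAlgebra.iota T) (TemperedAlgebra.iota S) → T = S) := by
  refine ⟨fun u v h α => ?_, fun u v h l => h.OM_smul l,
    fun T S h => TemperedAlgebra.eq_of_assoc_iota h⟩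
  induction α with
  | zero => exact h
  | succ α ih =>
    rw [pow_succ']
    exact ih.D
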